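/- Let $d, W, L\in\mathbb N$ with $1\le d\le W$ and $L\ge 1$, and let $b\ge 1$ and $B$ be real numbers with $((W+1)b)^L\le B$. Let $\mathcal F_{d,W,L,b}$ be the class of all functions $f:\mathbb R^d\to\mathbb R$ of the form $$f=h_L\circ \mathrm{ReLU}\circ h_{L-1}\circ\cdots\circ \mathrm{ReLU}\circ h_1,\qquad h_l(x)=W_lx+b_l,$$ with exactly $L$ affine layers of dimensions $d_0=d,d_1,\dots,d_{L-1},d_L=1$, where $\mathrm{ReLU}(x)=\max\{0,x\}$ acts coordinatewise, the width $\max\{d_0,\dots,d_L\}$ is at most $W$, and all entries of all $W_l$ and $b_l$ have absolute value at most $b$. For $\mathcal X\subseteq[0,1]^d$ and a class $\mathcal F$ of functions $\mathbb R^d\to\mathbb R$, let $N(\mathcal F,\|\cdot\|_\infty,\epsilon)$ be the $\epsilon$-covering number of $\mathcal F$ with respect to $\|f\|_\infty=\sup_{x\in\mathcal X}|f(x)|$, and let the effective dimension $dim=dim_{\mathcal X}(\mathcal F)$ be the infimum of all real $D\ge 0$ with $N(\mathcal F,\|\cdot\|_\infty,\epsilon)=O((1/\epsilon)^{D})$ as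 $\epsilon\to0$ (the implied constant may depend on $\mathcal X$, $\mathcal F$ and $D$). Then there are absolute constants $c,C>0$, independent of $d,W,L,b,B$ (and of $\mathcal X$, $\mathcal F$ below), such that the following hold. 1. For every $\mathcal X\subseteq[0,1]^d$ and every $\mathcal F\subseteq\mathcal F_{d,W,L,b}$: every $f\in\mathcal F$ maps $\mathcal X$ into $[-B,B]$; there is an exponent $D\le C\,W^2L$ with $N(\mathcal F,\|\cdot\|_\infty,\epsilon)=O((1/\epsilon)^{D})$ as $\epsilon\to 0$; and hence $dim_{\mathcal X}(\mathcal F)\le C\,W^2L$. 2. If moreover $W\ge 60$ and $L\ge 60$, then for $\mathcal X=[0,1]^d$ the full class satisfies $c\,W^2L\le dim_{[0,1]^d}(\mathcal F_{d,W,L,b})\le C\,W^2L$. -/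

import Mathlib

open scoped NNReal ENNReal

/-- Parameters `(W₁, b₁, …, W_L, b_L)` of a multilayer perceptron with exactly `L ≥ 1` affine
layers, input dimension `d` and output dimension `m`. A network is either one affine layer, or a
first affine layer followed (after a ReLU) by a network with one layer less. The dimensions
`d₀ = d, d₁, …, d_L = m` are part of the data and are otherwise arbitrary. -/
inductive MLP : ℕ → ℕ → ℕ → Type
  | last {d m : ℕ} (A : Matrix (Fin m) (Fin d) ℝ) (c : Fin m → ℝ) : MLP 1 d m
  | layer {L d k m : ℕ} (A : Matrix (Fin k) (Fin d) ℝ) (c : Fin k → ℝ) (N : MLP L k m) :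
      MLP (L + 1) d m

namespace MLP

/-- The ReLU activation, applied to every coordinate. -/
noncomputable def relu {n : ℕ} (v : Fin n → ℝ) : Fin n → ℝ := fun i => max 0 (v i)

/-- The function `h_L ∘ ReLU ∘ h_{L-1} ∘ ⋯ ∘ ReLU ∘ h₁` computed by the network, where
`h_l x = W_l x + b_l`. -/
noncomputable def eval : {L d m : ℕ} → MLP L d m → (Fin d → ℝ) → (Fin m → ℝ)
  | _, _, _, .last A c, x => A.mulVec x + c
  | _, _, _, .layer A c N, x => N.eval (relu (A.mulVec x + c))

/-- The width `max {d₀, …, d_L}` of the network. -/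
def width : {L d m : ℕ} → MLP L d m → ℕ
  | _, d, m, .last _ _ => max d m
  | _, d, _, .layer _ _ N => max d N.width

/-- All entries of all weight matrices and of all bias vectors have absolute value at most `b`. -/
def WeightsLE (b : ℝ) : {L d m : ℕ} → MLP L d m → Prop
  | _, _, _, .last A c => (∀ i j, |A i j| ≤ b) ∧ (∀ i, |c i| ≤ b)
  | _, _, _, .layer A c N => (∀ i j, |A i j| ≤ b) ∧ (∀ i, |c i| ≤ b) ∧ N.WeightsLE b

end MLP

/-- The class of all real-valued functions on `ℝ^d` that are computed by ReLU multilayer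
perceptrons with exactly `L` layers, width at most `W` and weights bounded by `b`. -/
def mlpClass (d W L : ℕ) (b : ℝ) : Set ((Fin d → ℝ) → ℝ) :=
  {f | ∃ N : MLP L d 1, N.width ≤ W ∧ N.WeightsLE b ∧ ∀ x, f x = N.eval x 0}

/-- The covering number `N(F, ‖·‖_∞, ε)` for the sup norm over `X`: the restrictions to `X` of the
functions in `F` are regarded as points of the space of functions `X → ℝ` with the
(extended) uniform distance `sup_{x ∈ X} |f x - g x|`. -/
noncomputable def supCoveringNumber {E : Type*} (X : Set E) (F : Set (E → ℝ)) (ε : ℝ≥0) : ℕ∞ :=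
  Metric.coveringNumber ε ((fun f : E → ℝ => UniformFun.ofFun (X.domRestrict f)) '' F)

/-- `N(F, ‖·‖_∞, ε) = O((1/ε)^D)` as `ε → 0`. Since the covering number is antitone in `ε`, the range
`0 < ε ≤ 1` could be replaced by any other range `0 < ε ≤ ε₀` on which it is finite. -/
def HasCoveringExponent {E : Type*} (X : Set E) (F : Set (E → ℝ)) (D : ℝ≥0) : Prop :=
  ∃ K : ℝ≥0, ∀ ε : ℝ≥0, 0 < ε → ε ≤ 1 →
    (supCoveringNumber X F ε : ℝ≥0∞) ≤ ((K * (1 / ε) ^ (D : ℝ) : ℝ≥0) : ℝ≥0∞)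

/-- The effective dimension of `F` on `X`: the infimum of all exponents `D ≥ 0` with
`N(F, ‖·‖_∞, ε) = O((1/ε)^D)` (and `∞` if there is no such exponent). -/
noncomputable def effectiveDim {E : Type*} (X : Set E) (F : Set (E → ℝ)) : ℝ≥0∞ :=
  ⨅ (D : ℝ≥0) (_ : HasCoveringExponent X F D), (D : ℝ≥0∞)

/-- The boundedness and covering assumption with exponent `D`: the features lie in the unit cube, all
functions of the class map the feature space into `[-B, B]`, and `N(F, ‖·‖_∞, ε) = O((1/ε)^D)`. -/
structure BoundedCovering {d : ℕ} (X : Set (Fin d → ℝ)) (F : Set ((Fin d → ℝ) → ℝ))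
    (B : ℝ) (D : ℝ≥0) : Prop where
  subset_cube : X ⊆ Set.Icc 0 1
  bounded : ∀ f ∈ F, ∀ x ∈ X, f x ∈ Set.Icc (-B) B
  covering : HasCoveringExponent X F D

/-! Upper bound: a network is determined by its widths and at most `L * W * (W + 1)` real parameters
in `[-b, b]`. On bounded inputs its output depends on these parameters in a Lipschitz way, so grids
in the parameter cubes give nets of size `O((1/ε) ^ (L * W * (W + 1)))` (`MLP.exists_net`).

Lower bound: it suffices to find a family in the class, parametrized by a cube of dimension of order
`W ^ 2 * L`, that expands distances (`card_le_of_hasCoveringExponent`). Networks of depth `3 * m +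
2` or more and width at least `3 * n + 2` carry `m` blocks, each with an `n × n` matrix `θ` of free
weights. A sum of disjoint tents is thresholded at `n` levels, giving features `u i`; the `k`-th
outer unit is `ReLU (∑ i, θ k i * u i x + (x - t k))`. For small `θ` the term `x - t k` alone
decides at the sample points whether this unit is active. So there the network is affine in `θ`,
with a linear part that does not depend on `θ`. For `m * n ^ 2` suitable sample points this linear
part is triangular with nonzero diagonal, hence injective, hence antilipschitz
(`le_of_hasCoveringExponent_mlpClass`). -/

/-! ### Upper bound: Lipschitz estimates and nets of parameters. -/

/-- Every cube `[-b, b]^ι` has an `ε`-net of at most `(K / ε) ^ |ι|` points. -/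
theorem exists_cube_net (b : ℝ) (hb : 0 ≤ b) (ι : Type*) [Fintype ι] :
    ∃ K : ℝ, 0 ≤ K ∧ ∀ ε : ℝ, 0 < ε → ε ≤ 1 → ∃ G : Finset (ι → ℝ),
      (G.card : ℝ) ≤ K * (1 / ε) ^ Fintype.card ι ∧ (∀ g ∈ G, ∀ i, |g i| ≤ b) ∧
      ∀ v : ι → ℝ, (∀ i, |v i| ≤ b) → ∃ g ∈ G, ∀ i, |v i - g i| ≤ ε := by
  classical
  refine ⟨(2 * b + 1) ^ Fintype.card ι, by positivity, fun ε hε hε1 => ?_⟩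
  set G₁ : Finset ℝ :=
    (Finset.range (⌊2 * b / ε⌋₊ + 1)).image (fun j : ℕ => -b + j * ε) with hG₁
  have hfl : (⌊2 * b / ε⌋₊ : ℝ) ≤ 2 * b / ε := Nat.floor_le (by positivity)
  refine ⟨Fintype.piFinset fun _ => G₁, ?_, ?_, ?_⟩
  · rw [Fintype.card_piFinset, Finset.prod_const, Finset.card_univ, ← mul_pow]
    push_cast
    gcongr
    have h1 : (G₁.card : ℝ) ≤ ⌊2 * b / ε⌋₊ + 1 := by
      exact_mod_cast Finset.card_image_le.trans (Finset.card_range _).le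
    have h2 : 1 ≤ 1 / ε := by rw [le_div_iff₀ hε]; linarith
    calc (G₁.card : ℝ) ≤ 2 * b / ε + 1 := by linarith
      _ ≤ 2 * b / ε + 1 / ε := by linarith
      _ = (2 * b + 1) * (1 / ε) := by ring
  · intro g hg i
    obtain ⟨j, hj, hj'⟩ := Finset.mem_image.1 (Fintype.mem_piFinset.1 hg i)
    have hj1 : (j : ℝ) ≤ 2 * b / ε :=
      le_trans (by exact_mod_cast Nat.lt_succ_iff.1 (Finset.mem_range.1 hj)) hfl
    rw [le_div_iff₀ hε] at hj1
    have : 0 ≤ (j : ℝ) * ε := by positivity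
    rw [← hj', abs_le]
    constructor <;> linarith
  · intro v hv
    refine ⟨fun i => -b + ⌊(v i + b) / ε⌋₊ * ε, Fintype.mem_piFinset.2 fun i => ?_, fun i => ?_⟩
    · refine Finset.mem_image.2 ⟨_, Finset.mem_range.2 (Nat.lt_succ_of_le ?_), rfl⟩
      refine Nat.floor_le_floor ?_
      gcongr
      linarith [(abs_le.1 (hv i)).2]
    · have h0 : 0 ≤ (v i + b) / ε := div_nonneg (by linarith [(abs_le.1 (hv i)).1]) hε.le
      have h1 := Nat.floor_le h0
      have h2 := (Nat.lt_floor_add_one ((v i + b) / ε)).le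
      rw [le_div_iff₀ hε] at h1
      rw [div_le_iff₀ hε] at h2
      rw [abs_le]
      constructor <;> nlinarith

namespace MLP

theorem abs_mulVec_le {k d : ℕ} {b : ℝ} {A : Matrix (Fin k) (Fin d) ℝ}
    (hA : ∀ i j, |A i j| ≤ b) (v : Fin d → ℝ) (i : Fin k) :
    |A.mulVec v i| ≤ d * b * ‖v‖ := by
  calc |A.mulVec v i| = |∑ j, A i j * v j| := rfl
    _ ≤ ∑ j, |A i j * v j| := Finset.abs_sum_le_sum_abs _ _
    _ ≤ ∑ _j : Fin d, b * ‖v‖ := by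
        refine Finset.sum_le_sum fun j _ => ?_
        rw [abs_mul]
        exact mul_le_mul (hA i j) (norm_le_pi_norm v j) (abs_nonneg _)
          ((abs_nonneg _).trans (hA i j))
    _ = d * b * ‖v‖ := by simp [mul_assoc]

theorem norm_relu_sub_le {n : ℕ} (v w : Fin n → ℝ) : ‖relu v - relu w‖ ≤ ‖v - w‖ := by
  refine (pi_norm_le_iff_of_nonneg (norm_nonneg _)).2 fun i => ?_
  refine le_trans ?_ (norm_le_pi_norm (v - w) i)
  simpa [relu, max_comm] using abs_max_sub_max_le_abs (v i) (w i) 0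

theorem norm_relu_le {n : ℕ} (v : Fin n → ℝ) : ‖relu v‖ ≤ ‖v‖ := by
  have h := norm_relu_sub_le v 0
  have h0 : relu (0 : Fin n → ℝ) = 0 := by ext i; simp [relu]
  simpa [h0] using h

theorem norm_affine_le {k d W : ℕ} {b R : ℝ} (hd : d ≤ W) (hb : 0 ≤ b) (hR : 1 ≤ R)
    {A : Matrix (Fin k) (Fin d) ℝ} {c : Fin k → ℝ} (hA : ∀ i j, |A i j| ≤ b)
    (hc : ∀ i, |c i| ≤ b) {x : Fin d → ℝ} (hx : ‖x‖ ≤ R) :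
    ‖A.mulVec x + c‖ ≤ (W + 1) * b * R := by
  refine (pi_norm_le_iff_of_nonneg (by positivity)).2 fun i => ?_
  have hdW : (d : ℝ) ≤ W := by exact_mod_cast hd
  calc ‖(A.mulVec x + c) i‖ ≤ |A.mulVec x i| + |c i| := abs_add_le _ _
    _ ≤ d * b * ‖x‖ + b := add_le_add (abs_mulVec_le hA x i) (hc i)
    _ ≤ W * b * R + b * R := by
        gcongr
        nlinarith
    _ = (W + 1) * b * R := by ring

theorem norm_affine_sub_le {k d W : ℕ} {b : ℝ} (hd : d ≤ W) (hb : 0 ≤ b)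
    {A : Matrix (Fin k) (Fin d) ℝ} (c : Fin k → ℝ) (hA : ∀ i j, |A i j| ≤ b)
    (x y : Fin d → ℝ) :
    ‖(A.mulVec x + c) - (A.mulVec y + c)‖ ≤ W * b * ‖x - y‖ := by
  refine (pi_norm_le_iff_of_nonneg (by positivity)).2 fun i => ?_
  have hdW : (d : ℝ) ≤ W := by exact_mod_cast hd
  rw [add_sub_add_right_eq_sub, ← Matrix.mulVec_sub]
  exact (abs_mulVec_le hA _ i).trans (by gcongr)

theorem norm_affine_sub_affine_le {k d W : ℕ} {δ R : ℝ} (hd : d ≤ W) (hδ : 0 ≤ δ) (hR : 1 ≤ R)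
    {A A' : Matrix (Fin k) (Fin d) ℝ} {c c' : Fin k → ℝ} (hA : ∀ i j, |A i j - A' i j| ≤ δ)
    (hc : ∀ i, |c i - c' i| ≤ δ) {x : Fin d → ℝ} (hx : ‖x‖ ≤ R) :
    ‖(A.mulVec x + c) - (A'.mulVec x + c')‖ ≤ (W + 1) * R * δ := by
  have h : (A.mulVec x + c) - (A'.mulVec x + c') = (A - A').mulVec x + (c - c') := by
    rw [Matrix.sub_mulVec]; abel
  rw [h]
  refine (norm_affine_le (A := A - A') (c := c - c') hd hδ hR hA hc hx).trans (le_of_eq (by ring))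

/-- Each layer multiplies the radius by at most `(W + 1) * b`; keeping the radius at least `1` lets
the bias be absorbed into this factor. -/
theorem norm_eval_le {W : ℕ} {b : ℝ} (hb : 1 ≤ b) {L d m : ℕ} (N : MLP L d m) :
    ∀ {R : ℝ}, 1 ≤ R → N.width ≤ W → N.WeightsLE b → ∀ {x : Fin d → ℝ}, ‖x‖ ≤ R →
      ‖N.eval x‖ ≤ ((W + 1) * b) ^ L * R := by
  induction N with
  | last A c =>
    intro R hR hw hN x hx
    simpa [eval] using norm_affine_le (le_of_max_le_left hw) (by linarith) hR hN.1 hN.2 hx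
  | @layer L d k m A c N ih =>
    intro R hR hw hN x hx
    have h1 := norm_affine_le (le_of_max_le_left hw) (by linarith) hR hN.1 hN.2.1 hx
    have hR' : 1 ≤ (W + 1) * b * R := by
      have : (0 : ℝ) ≤ W := by positivity
      nlinarith [mul_nonneg this (by linarith : (0 : ℝ) ≤ b),
        mul_le_mul hb hR (by norm_num) (by linarith), mul_nonneg (mul_nonneg this
        (by linarith : (0 : ℝ) ≤ b)) (by linarith : (0 : ℝ) ≤ R)]
    refine (ih hR' (le_of_max_le_right hw) hN.2.2 ((norm_relu_le _).trans h1)).trans (le_of_eq ?_)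
    ring

theorem norm_eval_sub_le {W : ℕ} {b : ℝ} (hb : 0 ≤ b) {L d m : ℕ} (N : MLP L d m) :
    N.width ≤ W → N.WeightsLE b → ∀ x y : Fin d → ℝ,
      ‖N.eval x - N.eval y‖ ≤ (W * b) ^ L * ‖x - y‖ := by
  induction N with
  | last A c =>
    intro hw hN x y
    simpa [eval] using norm_affine_sub_le (le_of_max_le_left hw) hb c hN.1 x y
  | @layer L d k m A c N ih =>
    intro hw hN x y
    have h1 := norm_affine_sub_le (le_of_max_le_left hw) hb c hN.1 x y
    refine (ih (le_of_max_le_right hw) hN.2.2 _ _).trans ?_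
    calc (W * b) ^ L * _ ≤ (W * b) ^ L * (W * b * ‖x - y‖) := by
          gcongr
          exact (norm_relu_sub_le _ _).trans h1
      _ = (W * b) ^ (L + 1) * ‖x - y‖ := by ring

theorem le_width_left {L d m : ℕ} (N : MLP L d m) : d ≤ N.width := by
  cases N <;> exact le_max_left _ _

/-- A net for the parameters of one affine layer. -/
theorem exists_affine_net (b : ℝ) (hb : 0 ≤ b) (k d W : ℕ) (hk : k ≤ W) (hd : d ≤ W) :
    ∃ K : ℝ, 0 ≤ K ∧ ∀ ε : ℝ, 0 < ε → ε ≤ 1 →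
      ∃ G : Finset (Matrix (Fin k) (Fin d) ℝ × (Fin k → ℝ)),
        (G.card : ℝ) ≤ K * (1 / ε) ^ (W * (W + 1)) ∧
        (∀ g ∈ G, (∀ i j, |g.1 i j| ≤ b) ∧ ∀ i, |g.2 i| ≤ b) ∧
        ∀ (A : Matrix (Fin k) (Fin d) ℝ) (c : Fin k → ℝ), (∀ i j, |A i j| ≤ b) →
          (∀ i, |c i| ≤ b) →
          ∃ g ∈ G, (∀ i j, |A i j - g.1 i j| ≤ ε) ∧ ∀ i, |c i - g.2 i| ≤ ε := by
  classical
  obtain ⟨K, hK, h⟩ := exists_cube_net b hb (Fin k × Fin d ⊕ Fin k)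
  refine ⟨K, hK, fun ε hε hε1 => ?_⟩
  obtain ⟨G, hcard, hG, hnet⟩ := h ε hε hε1
  refine ⟨G.image fun v => (Matrix.of fun i j => v (.inl (i, j)), fun i => v (.inr i)),
    ?_, ?_, ?_⟩
  · refine (Nat.cast_le.2 Finset.card_image_le).trans (hcard.trans ?_)
    gcongr
    · rw [le_div_iff₀ hε]; linarith
    · simp only [Fintype.card_sum, Fintype.card_prod, Fintype.card_fin]
      nlinarith [Nat.mul_le_mul hk hd]
  · simp only [Finset.mem_image]
    rintro _ ⟨v, hv, rfl⟩
    exact ⟨fun i j => hG v hv _, fun i => hG v hv _⟩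
  · intro A c hA hc
    obtain ⟨g, hg, hg'⟩ := hnet (Sum.elim (fun p => A p.1 p.2) c)
      (by rintro (p | i); exacts [hA _ _, hc _])
    exact ⟨_, Finset.mem_image_of_mem _ hg, fun i j => hg' (.inl (i, j)), fun i => hg' (.inr i)⟩

theorem exists_net_one (b : ℝ) (hb : 0 ≤ b) (W d m : ℕ) (hd : d ≤ W) (hm : m ≤ W) (R : ℝ)
    (hR : 1 ≤ R) :
    ∃ K : ℝ, 0 ≤ K ∧ ∀ ε : ℝ, 0 < ε → ε ≤ 1 → ∃ S : Finset (MLP 1 d m),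
      (S.card : ℝ) ≤ K * (1 / ε) ^ (W * (W + 1)) ∧
      (∀ N ∈ S, N.width ≤ W ∧ N.WeightsLE b) ∧
      ∀ N : MLP 1 d m, N.width ≤ W → N.WeightsLE b →
        ∃ N' ∈ S, ∀ x, ‖x‖ ≤ R → ‖N.eval x - N'.eval x‖ ≤ ε := by
  classical
  obtain ⟨K, hK, h⟩ := exists_affine_net b hb m d W hm hd
  set Λ : ℝ := (W + 1) * R with hΛ
  have hΛ1 : 1 ≤ Λ := by
    have : (0 : ℝ) ≤ W := by positivity
    nlinarith
  refine ⟨K * Λ ^ (W * (W + 1)), by positivity, fun ε hε hε1 => ?_⟩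
  obtain ⟨G, hcard, hG, hnet⟩ := h (ε / Λ) (by positivity)
    ((div_le_one (by positivity)).2 (by linarith))
  refine ⟨G.image fun g => MLP.last g.1 g.2, ?_, ?_, ?_⟩
  · refine (Nat.cast_le.2 Finset.card_image_le).trans (hcard.trans (le_of_eq ?_))
    rw [mul_assoc, ← mul_pow]
    congr 2
    field_simp
  · simp only [Finset.mem_image]
    rintro _ ⟨g, hg, rfl⟩
    exact ⟨max_le hd hm, hG g hg⟩
  · intro N hw hN
    cases N with
    | last A c =>
      obtain ⟨g, hg, h1, h2⟩ := hnet A c hN.1 hN.2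
      refine ⟨_, Finset.mem_image_of_mem _ hg, fun x hx => ?_⟩
      refine (norm_affine_sub_affine_le hd (by positivity) hR h1 h2 hx).trans (le_of_eq ?_)
      rw [← hΛ]; field_simp
    -- A further layer would leave a network with zero layers, and there is none.
    | layer A c N => cases N

/-- Peel off the first layer. Half of the error budget goes to the net for the tail; the other half
goes to the first layer, whose error the tail magnifies by its Lipschitz constant. The unknown first
hidden width takes finitely many values, so it affects only the constant. -/
theorem exists_net (b : ℝ) (hb : 1 ≤ b) (W : ℕ) (L : ℕ) :
    ∀ (d m : ℕ), d ≤ W → m ≤ W → ∀ R : ℝ, 1 ≤ R →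
    ∃ K : ℝ, 0 ≤ K ∧ ∀ ε : ℝ, 0 < ε → ε ≤ 1 → ∃ S : Finset (MLP (L + 1) d m),
      (S.card : ℝ) ≤ K * (1 / ε) ^ ((L + 1) * (W * (W + 1))) ∧
      (∀ N ∈ S, N.width ≤ W ∧ N.WeightsLE b) ∧
      ∀ N : MLP (L + 1) d m, N.width ≤ W → N.WeightsLE b →
        ∃ N' ∈ S, ∀ x, ‖x‖ ≤ R → ‖N.eval x - N'.eval x‖ ≤ ε := by
  classical
  have hb0 : 0 ≤ b := by linarith
  induction L with
  | zero =>
    intro d m hd hm R hR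
    simpa using exists_net_one b hb0 W d m hd hm R hR
  | succ L ih =>
    intro d m hd hm R hR
    have hW0 : (0 : ℝ) ≤ W := by positivity
    -- Radius of the ball that contains the outputs of the first layer; the net for the tail has to
    -- be accurate there.
    set R' : ℝ := (W + 1) * b * R with hR'def
    have hR' : 1 ≤ R' := by
      have h1 : 1 ≤ b * R := by nlinarith
      have h2 : R' = W * (b * R) + b * R := by rw [hR'def]; ring
      rw [h2]
      nlinarith
    have hk : ∀ k : Fin (W + 1), (k : ℕ) ≤ W := fun k => Nat.lt_succ_iff.1 k.2
    choose K₁ hK₁ h₁ using fun k : Fin (W + 1) => exists_affine_net b hb0 k d W (hk k) hd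
    choose K₂ hK₂ h₂ using fun k : Fin (W + 1) => ih k m (hk k) hm R' hR'
    -- Precision `ε / Λ` in the first layer costs at most `ε / 2` at the output. The summand `1`
    -- ensures `1 ≤ Λ`.
    set Λ : ℝ := 2 * (((W * b) ^ (L + 1) + 1) * ((W + 1) * R)) with hΛ
    have hΛ1 : 1 ≤ Λ := by
      have h1 : 0 ≤ ((W : ℝ) * b) ^ (L + 1) := by positivity
      have h2 : 1 ≤ ((W : ℝ) + 1) * R := by nlinarith
      nlinarith
    refine ⟨∑ k, K₁ k * Λ ^ (W * (W + 1)) * (K₂ k * 2 ^ ((L + 1) * (W * (W + 1)))),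
      Finset.sum_nonneg fun k _ => by have := hK₁ k; have := hK₂ k; positivity,
      fun ε hε hε1 => ?_⟩
    choose G hGcard hG hGnet using fun k => h₁ k (ε / Λ) (by positivity)
      ((div_le_one (by positivity)).2 (by linarith))
    choose S hScard hS hSnet using fun k => h₂ k (ε / 2) (by positivity) (by linarith)
    refine ⟨Finset.univ.biUnion fun k => (G k ×ˢ S k).image fun p => MLP.layer p.1.1 p.1.2 p.2,
      ?_, ?_, ?_⟩
    · refine (Nat.cast_le.2 Finset.card_biUnion_le).trans ?_
      rw [Finset.sum_mul]
      push_cast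
      refine Finset.sum_le_sum fun k _ => ?_
      refine (Nat.cast_le.2 Finset.card_image_le).trans ?_
      rw [Finset.card_product]
      push_cast
      have hK1 := hK₁ k
      refine (mul_le_mul (hGcard k) (hScard k) (by positivity) (by positivity)).trans
        (le_of_eq ?_)
      have e1 : 1 / (ε / Λ) = Λ * (1 / ε) := by field_simp
      have e2 : 1 / (ε / 2) = 2 * (1 / ε) := by field_simp
      rw [e1, e2, mul_pow, mul_pow,
        show (L + 1 + 1) * (W * (W + 1)) = W * (W + 1) + (L + 1) * (W * (W + 1)) by ring, pow_add]
      ring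
    · simp only [Finset.mem_biUnion, Finset.mem_image, Finset.mem_product]
      rintro _ ⟨k, -, p, ⟨hp1, hp2⟩, rfl⟩
      exact ⟨max_le hd (hS k _ hp2).1, (hG k _ hp1).1, (hG k _ hp1).2, (hS k _ hp2).2⟩
    · intro N hw hN
      obtain _ | ⟨A, c, N⟩ := N
      rename_i k
      have hkW : k ≤ W := (le_width_left N).trans (le_of_max_le_right hw)
      obtain ⟨g, hg, hg1, hg2⟩ := hGnet ⟨k, Nat.lt_succ_of_le hkW⟩ A c hN.1 hN.2.1
      obtain ⟨N', hN', hNN'⟩ := hSnet ⟨k, Nat.lt_succ_of_le hkW⟩ N (le_of_max_le_right hw) hN.2.2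
      have hSN' := hS _ N' hN'
      refine ⟨MLP.layer g.1 g.2 N', ?_, fun x hx => ?_⟩
      · simp only [Finset.mem_biUnion, Finset.mem_image, Finset.mem_product]
        exact ⟨⟨k, Nat.lt_succ_of_le hkW⟩, Finset.mem_univ _, (g, N'), ⟨hg, hN'⟩, rfl⟩
      · have t1 := hNN' (relu (A.mulVec x + c))
          ((norm_relu_le _).trans (norm_affine_le hd hb0 hR hN.1 hN.2.1 hx))
        have t2 := norm_eval_sub_le hb0 N' hSN'.1 hSN'.2 (relu (A.mulVec x + c))
          (relu (g.1.mulVec x + g.2))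
        have t3 := (norm_relu_sub_le (A.mulVec x + c) (g.1.mulVec x + g.2)).trans
          (norm_affine_sub_affine_le (W := W) hd (by positivity : 0 ≤ ε / Λ) hR hg1 hg2 hx)
        have t4 : (W * b) ^ (L + 1) * ((W + 1) * R * (ε / Λ)) ≤ ε / 2 := by
          have e : ε / 2 = ((W * b) ^ (L + 1) + 1) * ((W + 1) * R * (ε / Λ)) := by
            rw [show ((W * b) ^ (L + 1) + 1) * ((W + 1) * R * (ε / Λ))
              = Λ / 2 * (ε / Λ) by rw [hΛ]; ring]
            field_simp
          rw [e]
          gcongr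
          linarith
        calc ‖(MLP.layer A c N).eval x - (MLP.layer g.1 g.2 N').eval x‖
            ≤ ‖N.eval (relu (A.mulVec x + c)) - N'.eval (relu (A.mulVec x + c))‖ +
              ‖N'.eval (relu (A.mulVec x + c)) - N'.eval (relu (g.1.mulVec x + g.2))‖ :=
                norm_sub_le_norm_sub_add_norm_sub _ _ _
          _ ≤ ε / 2 + (W * b) ^ (L + 1) * ((W + 1) * R * (ε / Λ)) := by
              refine add_le_add t1 (t2.trans ?_)
              gcongr
          _ ≤ ε := by linarith

end MLP

/-! ### Upper bound: boundedness and covering exponent of subclasses. -/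

theorem norm_le_one_of_mem_cube {d : ℕ} {x : Fin d → ℝ} (hx : x ∈ Set.Icc (0 : Fin d → ℝ) 1) :
    ‖x‖ ≤ 1 := by
  refine (pi_norm_le_iff_of_nonneg zero_le_one).2 fun i => ?_
  rw [Real.norm_eq_abs, abs_of_nonneg (hx.1 i)]
  exact hx.2 i

theorem mlpClass_mem_Icc {d W L : ℕ} {b B : ℝ} (hb : 1 ≤ b) (hB : (((W : ℝ) + 1) * b) ^ L ≤ B)
    {f : (Fin d → ℝ) → ℝ} (hf : f ∈ mlpClass d W L b) {x : Fin d → ℝ}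
    (hx : x ∈ Set.Icc (0 : Fin d → ℝ) 1) : f x ∈ Set.Icc (-B) B := by
  obtain ⟨N, hw, hN, hNf⟩ := hf
  have h := (norm_le_pi_norm (N.eval x) 0).trans
    (N.norm_eval_le hb le_rfl hw hN (norm_le_one_of_mem_cube hx))
  rw [← hNf, Real.norm_eq_abs, mul_one] at h
  exact abs_le.1 (h.trans hB)

/-- The net may lie outside `F`, whereas the covering number takes its centres in `F`; moving the
centres into `F` doubles the radius. -/
theorem supCoveringNumber_le_of_net {E : Type*} {X : Set E} {F : Set (E → ℝ)} {ε : ℝ≥0}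
    (S : Finset (E → ℝ)) (h : ∀ f ∈ F, ∃ g ∈ S, ∀ x ∈ X, |f x - g x| ≤ ε / 2) :
    supCoveringNumber X F ε ≤ S.card := by
  classical
  set r : (E → ℝ) → UniformFun X ℝ := fun f => UniformFun.ofFun (X.domRestrict f)
  have hcov : Metric.IsCover (ε / 2) (r '' F) (r '' S) := by
    rintro _ ⟨f, hf, rfl⟩
    obtain ⟨g, hg, hfg⟩ := h f hf
    refine ⟨r g, ⟨g, hg, rfl⟩, UniformFun.edist_le.2 fun x => ?_⟩
    have h1 := hfg x x.2
    rw [edist_dist]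
    refine ENNReal.ofReal_le_of_le_toReal ?_
    simpa [r, Real.dist_eq] using h1
  have h2 := Metric.coveringNumber_two_mul_le_externalCoveringNumber (ε / 2) (r '' F)
  rw [mul_div_cancel₀ _ (two_ne_zero)] at h2
  calc supCoveringNumber X F ε ≤ _ := h2
    _ ≤ (r '' S).encard := hcov.externalCoveringNumber_le_encard
    _ ≤ (S : Set (E → ℝ)).encard := Set.encard_image_le _ _
    _ = S.card := Set.encard_coe_eq_coe_finsetCard S

theorem hasCoveringExponent_of_subset_mlpClass {d W L : ℕ} {b : ℝ} (hd : 1 ≤ d) (hdW : d ≤ W)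
    (hL : 1 ≤ L) (hb : 1 ≤ b) {X : Set (Fin d → ℝ)} {F : Set ((Fin d → ℝ) → ℝ)}
    (hX : X ⊆ Set.Icc 0 1) (hF : F ⊆ mlpClass d W L b) :
    HasCoveringExponent X F (L * (W * (W + 1)) : ℕ) := by
  classical
  obtain ⟨L, rfl⟩ := Nat.exists_eq_add_of_le' hL
  obtain ⟨K, hK, h⟩ := MLP.exists_net b hb W L d 1 hdW (hd.trans hdW) 1 le_rfl
  refine ⟨(K * 2 ^ ((L + 1) * (W * (W + 1)))).toNNReal, fun ε hε hε1 => ?_⟩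
  have hε' : (0 : ℝ) < ε := hε
  have hε1' : (ε : ℝ) ≤ 1 := hε1
  obtain ⟨S, hcard, -, hnet⟩ := h (ε / 2) (by positivity) (by linarith)
  have hle : supCoveringNumber X F ε ≤ (S.image fun N x => N.eval x 0).card := by
    refine supCoveringNumber_le_of_net _ fun f hf => ?_
    obtain ⟨N, hw, hN, hNf⟩ := hF hf
    obtain ⟨N', hN', hNN'⟩ := hnet N hw hN
    refine ⟨_, Finset.mem_image_of_mem _ hN', fun x hx => ?_⟩
    rw [hNf]
    exact (norm_le_pi_norm (N.eval x - N'.eval x) 0).trans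
      (hNN' x (norm_le_one_of_mem_cube (hX hx)))
  have hle' : supCoveringNumber X F ε ≤ S.card :=
    hle.trans (by exact_mod_cast Finset.card_image_le)
  calc (supCoveringNumber X F ε : ℝ≥0∞) ≤ ((S.card : ℕ∞) : ℝ≥0∞) := by exact_mod_cast hle'
    _ = ((S.card : ℝ≥0) : ℝ≥0∞) := by simp
    _ ≤ _ := by
      rw [ENNReal.coe_le_coe, ← NNReal.coe_le_coe, NNReal.coe_natCast, NNReal.coe_natCast,
        NNReal.rpow_natCast, NNReal.coe_mul, Real.coe_toNNReal _ (by positivity), NNReal.coe_pow,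
        NNReal.coe_div, NNReal.coe_one, mul_assoc, ← mul_pow]
      refine hcard.trans (le_of_eq ?_)
      congr 2
      field_simp

/-! ### Lower bound: composing layers over arbitrary finite index types. -/

theorem MLP.WeightsLE.mono {b b' : ℝ} (h : b ≤ b') {L d m : ℕ} {N : MLP L d m}
    (hN : N.WeightsLE b) : N.WeightsLE b' := by
  induction N with
  | last A c => exact ⟨fun i j => (hN.1 i j).trans h, fun i => (hN.2 i).trans h⟩
  | layer A c N ih =>
    exact ⟨fun i j => (hN.1 i j).trans h, fun i => (hN.2.1 i).trans h, ih hN.2.2⟩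

theorem mlpClass_mono {d W L : ℕ} {b b' : ℝ} (h : b ≤ b') :
    mlpClass d W L b ⊆ mlpClass d W L b' :=
  fun _ ⟨N, hw, hN, hf⟩ => ⟨N, hw, hN.mono h, hf⟩

/-- The class `mlpClass` for inputs indexed by an arbitrary finite type. -/
def mlpClassOn (ι : Type*) (W L : ℕ) (b : ℝ) : Set ((ι → ℝ) → ℝ) :=
  {f | ∀ (d : ℕ) (e : ι ≃ Fin d), (fun x : Fin d → ℝ => f (x ∘ e)) ∈ mlpClass d W L b}

/-- Affine forms whose coefficients and constant term are bounded by `b`. -/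
def IsBoundedAffine {ι : Type*} [Fintype ι] (b : ℝ) (φ : (ι → ℝ) → ℝ) : Prop :=
  ∃ (a : ι → ℝ) (c : ℝ), (∀ i, |a i| ≤ b) ∧ |c| ≤ b ∧ ∀ x, φ x = ∑ i, a i * x i + c

theorem IsBoundedAffine.mem_mlpClassOn {ι : Type*} [Fintype ι] {W : ℕ} {b : ℝ}
    (hι : Fintype.card ι ≤ W) (hW : 1 ≤ W) {φ : (ι → ℝ) → ℝ} (hφ : IsBoundedAffine b φ) :
    φ ∈ mlpClassOn ι W 1 b := by
  intro d e
  obtain ⟨a, c, ha, hc, h⟩ := hφ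
  have hd : d ≤ W := by simpa [Fintype.card_congr e] using hι
  refine ⟨.last (Matrix.of fun _ j => a (e.symm j)) (fun _ => c), max_le hd hW,
    ⟨fun _ j => ha _, fun _ => hc⟩, fun x => ?_⟩
  simp only [h, MLP.eval, Pi.add_apply, Matrix.mulVec, dotProduct, Matrix.of_apply]
  congr 1
  exact Fintype.sum_equiv e _ _ fun i => by simp

theorem comp_relu_mem_mlpClassOn {ι κ : Type*} [Fintype ι] [Fintype κ] {W L : ℕ} {b : ℝ}
    (hι : Fintype.card ι ≤ W) {g : (κ → ℝ) → ℝ} (hg : g ∈ mlpClassOn κ W L b)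
    {φ : κ → (ι → ℝ) → ℝ} (hφ : ∀ k, IsBoundedAffine b (φ k)) :
    (fun x => g fun k => max 0 (φ k x)) ∈ mlpClassOn ι W (L + 1) b := by
  intro d e
  choose a c ha hc h using hφ
  have hd : d ≤ W := by simpa [Fintype.card_congr e] using hι
  set e' := Fintype.equivFin κ
  obtain ⟨N, hw, hN, hf⟩ := hg _ e'
  refine ⟨.layer (Matrix.of fun p j => a (e'.symm p) (e.symm j)) (fun p => c (e'.symm p)) N,
    max_le hd hw, ⟨fun p j => ha _ _, fun p => hc _, hN⟩, fun x => ?_⟩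
  rw [MLP.eval, ← hf]
  refine congrArg g (funext fun k => ?_)
  simp only [h, Function.comp_apply, MLP.relu, Pi.add_apply, Matrix.mulVec, dotProduct,
    Matrix.of_apply, Equiv.symm_apply_apply]
  congr 2
  exact Fintype.sum_equiv e _ _ fun i => by simp

/-! ### Lower bound: networks that carry the input and a running sum. -/

/-- A hidden state: the input `x`, an accumulator `a` and further units `v`. -/
def hiddenState {κ : Type*} (x a : ℝ) (v : κ → ℝ) : Unit ⊕ Unit ⊕ κ → ℝ :=
  Sum.elim (fun _ => x) (Sum.elim (fun _ => a) v)

theorem relu_hiddenState {ι κ : Type*} (ξ α : (ι → ℝ) → ℝ) (ν : κ → (ι → ℝ) → ℝ)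
    (s : ι → ℝ) :
    (fun k => max 0 ((Sum.elim (fun _ => ξ) (Sum.elim (fun _ => α) ν) :
      Unit ⊕ Unit ⊕ κ → (ι → ℝ) → ℝ) k s)) =
    hiddenState (max 0 (ξ s)) (max 0 (α s)) (fun k => max 0 (ν k s)) := by
  ext k
  rcases k with _ | _ | k <;> rfl

/-- The form `p x + q a + ∑ₖ wₖ vₖ + c` on hidden states. -/
theorem isBoundedAffine_hiddenState {κ : Type*} [Fintype κ] {b p q c : ℝ} {w : κ → ℝ}
    (hp : |p| ≤ b) (hq : |q| ≤ b) (hw : ∀ k, |w k| ≤ b) (hc : |c| ≤ b) :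
    IsBoundedAffine b (fun s : Unit ⊕ Unit ⊕ κ → ℝ =>
      p * s (.inl ()) + q * s (.inr (.inl ())) + ∑ k, w k * s (.inr (.inr k)) + c) := by
  refine ⟨Sum.elim (fun _ => p) (Sum.elim (fun _ => q) w), c, ?_, hc, fun s => ?_⟩
  · rintro (_ | _ | k)
    exacts [hp, hq, hw k]
  · simp [add_assoc]

/-- One hidden layer between hidden states which keeps `x`, adds `∑ₖ wₖ vₖ` to the accumulator
and computes the new units `∑ₖ ρ l k vₖ + p l * x + c l`. -/
theorem exists_mlpClassOn_hidden_layer {κ κ' : Type*} [Fintype κ] [Fintype κ'] {W L : ℕ}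
    (hκ : Fintype.card κ + 2 ≤ W) {g : (Unit ⊕ Unit ⊕ κ' → ℝ) → ℝ}
    (hg : g ∈ mlpClassOn (Unit ⊕ Unit ⊕ κ') W L 1) {w : κ → ℝ} {ρ : κ' → κ → ℝ} {p c : κ' → ℝ}
    (hw : ∀ k, |w k| ≤ 1) (hρ : ∀ l k, |ρ l k| ≤ 1) (hp : ∀ l, |p l| ≤ 1) (hc : ∀ l, |c l| ≤ 1) :
    ∃ f ∈ mlpClassOn (Unit ⊕ Unit ⊕ κ) W (L + 1) 1, ∀ (x a : ℝ) (v : κ → ℝ), 0 ≤ x →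
      0 ≤ a + ∑ k, w k * v k →
      f (hiddenState x a v) = g (hiddenState x (a + ∑ k, w k * v k)
        (fun l => max 0 (p l * x + ∑ k, ρ l k * v k + c l))) := by
  have hcard : Fintype.card (Unit ⊕ Unit ⊕ κ) ≤ W := by
    simp only [Fintype.card_sum, Fintype.card_unit]; omega
  refine ⟨_, comp_relu_mem_mlpClassOn hcard hg (φ := Sum.elim
    (fun _ s => 1 * s (.inl ()) + 0 * s (.inr (.inl ())) + ∑ k, 0 * s (.inr (.inr k)) + 0)
    (Sum.elim (fun _ s =>
      0 * s (.inl ()) + 1 * s (.inr (.inl ())) + ∑ k, w k * s (.inr (.inr k)) + 0)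
      (fun l s => p l * s (.inl ()) + 0 * s (.inr (.inl ())) +
        ∑ k, ρ l k * s (.inr (.inr k)) + c l))) ?_, fun x a v hx ha => ?_⟩
  · rintro (_ | _ | l)
    · exact isBoundedAffine_hiddenState (by simp) (by simp) (by simp) (by simp)
    · exact isBoundedAffine_hiddenState (by simp) (by simp) hw (by simp)
    · exact isBoundedAffine_hiddenState (hp l) (by simp) (hρ l) (hc l)
  -- ReLU leaves the input and the accumulator unchanged because both are nonnegative.
  · rw [relu_hiddenState]
    simp [hiddenState, hx, ha]

/-- The tent function with support `[t, t + 2h]` and height `h / 2`. -/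
noncomputable def tent (h t x : ℝ) : ℝ :=
  1 / 2 * max 0 (x - t) - max 0 (x - (t + h)) + 1 / 2 * max 0 (x - (t + 2 * h))

/-- The function computed by one block of three hidden layers. -/
noncomputable def blockFun {n : ℕ} (h : ℝ) (t τ : Fin n → ℝ) (θ : Fin n → Fin n → ℝ) (x : ℝ) : ℝ :=
  ∑ k, max 0 (∑ i, θ k i * max 0 (∑ l, tent h (t l) x - τ i) + (x - t k))

/-- The first layer adds the old units to the accumulator and forms the `3 * n` hinges of the tents,
the second thresholds the sum of the tents, the third applies `θ`. All weights are at most `1`,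
which is why the tents have slope `1 / 2`. -/
theorem exists_mlpClassOn_block {n W L : ℕ} (hW : 3 * n + 2 ≤ W) {h : ℝ} {t τ : Fin n → ℝ}
    {θ : Fin n → Fin n → ℝ} (hh : 0 ≤ h) (ht : ∀ k, 0 ≤ t k ∧ t k + 2 * h ≤ 1)
    (hτ : ∀ i, |τ i| ≤ 1) (hθ : ∀ k i, |θ k i| ≤ 1)
    {g : (Unit ⊕ Unit ⊕ Fin n → ℝ) → ℝ} {G : ℝ → ℝ}
    (hg : g ∈ mlpClassOn (Unit ⊕ Unit ⊕ Fin n) W L 1)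
    (hgG : ∀ (x a : ℝ) (v : Fin n → ℝ), 0 ≤ x → 0 ≤ a → (∀ k, 0 ≤ v k) →
      g (hiddenState x a v) = a + ∑ k, v k + G x) :
    ∃ f ∈ mlpClassOn (Unit ⊕ Unit ⊕ Fin n) W (L + 3) 1, ∀ (x a : ℝ) (v : Fin n → ℝ),
      0 ≤ x → 0 ≤ a → (∀ k, 0 ≤ v k) →
      f (hiddenState x a v) = a + ∑ k, v k + (blockFun h t τ θ x + G x) := by
  have hn : Fintype.card (Fin n) + 2 ≤ W := by simp; omega
  have hn3 : Fintype.card (Fin n × Fin 3) + 2 ≤ W := by simp; omega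
  -- Layers are prepended, so the third layer of the block comes first.
  obtain ⟨g₁, hg₁, e₁⟩ := exists_mlpClassOn_hidden_layer hn hg (w := fun _ => 0) (ρ := θ)
    (p := fun _ => 1) (c := fun k => -t k) (by simp) hθ (by simp)
    (fun k => by have := ht k; rw [abs_le]; constructor <;> linarith)
  obtain ⟨g₂, hg₂, e₂⟩ := exists_mlpClassOn_hidden_layer hn3 hg₁ (w := fun _ => 0)
    (ρ := fun _ q => ![1 / 2, -1, 1 / 2] q.2) (p := fun _ => 0) (c := fun i => -τ i)
    (by simp)
    (by rintro _ ⟨k, i⟩; fin_cases i <;> norm_num [abs_le]) (by simp) (by simpa using hτ)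
  obtain ⟨g₃, hg₃, e₃⟩ := exists_mlpClassOn_hidden_layer hn hg₂ (w := fun _ => 1)
    (ρ := fun _ _ => 0) (p := fun _ => 1)
    (c := fun q : Fin n × Fin 3 => -(t q.1 + ![0, h, 2 * h] q.2)) (by simp) (by simp) (by simp)
    (by
      rintro ⟨k, i⟩
      have := ht k
      rw [abs_neg, abs_le]
      fin_cases i <;> simp <;> constructor <;> linarith)
  refine ⟨g₃, hg₃, fun x a v hx ha hv => ?_⟩
  have hv' : 0 ≤ ∑ k, v k := Finset.sum_nonneg fun k _ => hv k
  rw [e₃ x a v hx (by simpa using add_nonneg ha hv'), e₂ _ _ _ hx (by simpa using add_nonneg ha hv'),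
    e₁ _ _ _ hx (by simpa using add_nonneg ha hv'),
    hgG _ _ _ hx (by simpa using add_nonneg ha hv') fun k => le_max_left _ _]
  simp only [zero_mul, one_mul, Finset.sum_const_zero, add_zero, zero_add, Fintype.sum_prod_type,
    Fin.sum_univ_three]
  rw [add_assoc (a + ∑ k, v k)]
  congr 2
  refine Finset.sum_congr rfl fun k _ => ?_
  have e : ∀ i, ∑ l, tent h (t l) x - τ i = ∑ l, (![1 / 2, -1, 1 / 2] 0 *
      max 0 (x + -(t l + ![0, h, 2 * h] 0)) + ![1 / 2, -1, 1 / 2] 1 *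
      max 0 (x + -(t l + ![0, h, 2 * h] 1)) + ![1 / 2, -1, 1 / 2] 2 *
      max 0 (x + -(t l + ![0, h, 2 * h] 2))) + -τ i := by
    intro i
    rw [sub_eq_add_neg]
    congr 1
    refine Finset.sum_congr rfl fun l _ => ?_
    simp [tent]
    ring_nf
  simp only [e]
  congr 1
  ring

/-- The `r` extra layers only pass the accumulated sum on; they bring the depth to any prescribed
larger value. -/
theorem exists_mlpClassOn_sum_blocks {n W : ℕ} (hW : 3 * n + 2 ≤ W) {h : ℝ}
    {t : ℕ → Fin n → ℝ} {τ : Fin n → ℝ} {θ : ℕ → Fin n → Fin n → ℝ} (hh : 0 ≤ h)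
    (hτ : ∀ i, |τ i| ≤ 1) (hθ : ∀ j k i, |θ j k i| ≤ 1) (r m : ℕ)
    (ht : ∀ j < m, ∀ k, 0 ≤ t j k ∧ t j k + 2 * h ≤ 1) :
    ∃ f ∈ mlpClassOn (Unit ⊕ Unit ⊕ Fin n) W (r + 1 + 3 * m) 1, ∀ (x a : ℝ) (v : Fin n → ℝ),
      0 ≤ x → 0 ≤ a → (∀ k, 0 ≤ v k) →
      f (hiddenState x a v) =
        a + ∑ k, v k + ∑ j ∈ Finset.range m, blockFun h (t j) τ (θ j) x := by
  have hn : Fintype.card (Fin n) + 2 ≤ W := by simp; omega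
  induction m with
  | zero =>
    induction r with
    | zero =>
      refine ⟨_, IsBoundedAffine.mem_mlpClassOn (by simp; omega) (by omega)
        (isBoundedAffine_hiddenState (p := 0) (q := 1) (c := 0) (w := fun _ => 1)
          (by simp) (by simp) (by simp) (by simp)), fun x a v _ _ _ => ?_⟩
      simp [hiddenState]
    | succ r ih =>
      obtain ⟨g, hg, e⟩ := ih
      obtain ⟨f, hf, e'⟩ := exists_mlpClassOn_hidden_layer hn hg (w := fun _ => 1)
        (ρ := fun _ _ => 0) (p := fun _ => 0) (c := fun _ => 0) (by simp) (by simp) (by simp)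
        (by simp)
      refine ⟨f, hf, fun x a v hx ha hv => ?_⟩
      have hv' : 0 ≤ a + ∑ k, v k := add_nonneg ha (Finset.sum_nonneg fun k _ => hv k)
      rw [e' _ _ _ hx (by simpa using hv'), e _ _ _ hx (by simpa using hv') (by simp)]
      simp
  | succ m ih =>
    obtain ⟨g, hg, e⟩ := ih fun j hj => ht j (by omega)
    obtain ⟨f, hf, e'⟩ := exists_mlpClassOn_block hW hh (ht m (by omega)) hτ (hθ m) hg e
    refine ⟨f, hf, fun x a v hx ha hv => ?_⟩
    rw [e' x a v hx ha hv, Finset.sum_range_succ, add_comm (blockFun _ _ _ _ _)]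

theorem exists_mlpClass_sum_blocks {d n W : ℕ} (hd : 1 ≤ d) (hdW : d ≤ W) (hW : 3 * n + 2 ≤ W)
    {h : ℝ} {t : ℕ → Fin n → ℝ} {τ : Fin n → ℝ} {θ : ℕ → Fin n → Fin n → ℝ} (hh : 0 ≤ h)
    (hτ : ∀ i, |τ i| ≤ 1) (hθ : ∀ j k i, |θ j k i| ≤ 1) (r m : ℕ)
    (ht : ∀ j < m, ∀ k, 0 ≤ t j k ∧ t j k + 2 * h ≤ 1) :
    ∃ f ∈ mlpClass d W (r + 1 + 3 * m + 1) 1, ∀ x : Fin d → ℝ, 0 ≤ x ⟨0, hd⟩ →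
      f x = ∑ j ∈ Finset.range m, blockFun h (t j) τ (θ j) (x ⟨0, hd⟩) := by
  obtain ⟨g, hg, e⟩ := exists_mlpClassOn_sum_blocks hW hh hτ hθ r m ht
  refine ⟨_, comp_relu_mem_mlpClassOn (by simpa using hdW) hg (φ := Sum.elim
    (fun _ s => s ⟨0, hd⟩) (Sum.elim (fun _ _ => 0) (fun _ _ => 0))) ?_ d (Equiv.refl _),
    fun x hx => ?_⟩
  · rintro (_ | _ | k)
    · refine ⟨Pi.single ⟨0, hd⟩ 1, 0, fun i => ?_, by simp, fun x => ?_⟩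
      · by_cases hi : i = ⟨0, hd⟩ <;> simp [hi]
      · simp [Pi.single_apply]
    · exact ⟨0, 0, by simp, by simp, by simp⟩
    · exact ⟨0, 0, by simp, by simp, by simp⟩
  · refine (congrArg g (relu_hiddenState (fun s : Fin d → ℝ => s ⟨0, hd⟩) (fun _ => 0)
      (fun _ _ => 0) x)).trans ?_
    rw [e _ _ _ (le_max_left _ _) (le_max_left _ _) fun _ => le_max_left _ _]
    simp [hx]

/-! ### Lower bound: expanding families and triangular matrices. -/

/-- A family that is parametrized by a cube and expands distances has at least as large a covering
exponent as the dimension of the cube. -/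
theorem card_le_of_hasCoveringExponent {E : Type*} {X : Set E} {F : Set (E → ℝ)} {D : ℝ≥0}
    (hD : HasCoveringExponent X F D) {ι : Type*} [Fintype ι] (f : (ι → ℝ) → E → ℝ) {δ κ : ℝ}
    (hδ : 0 < δ) (hκ : 0 < κ) (hf : ∀ θ, (∀ i, θ i ∈ Set.Icc 0 δ) → f θ ∈ F)
    (hsep : ∀ θ θ', (∀ i, θ i ∈ Set.Icc 0 δ) → (∀ i, θ' i ∈ Set.Icc 0 δ) → θ ≠ θ' →
      ∃ x ∈ X, κ * ‖θ - θ'‖ ≤ |f θ x - f θ' x|) :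
    (Fintype.card ι : ℝ≥0) ≤ D := by
  obtain ⟨K, hK⟩ := hD
  -- A parameter grid of mesh `δ / R` has images at distance at least `κ * δ / R = 3 * ε` for `ε = c
  -- / R`. They are thus strictly `2 * ε`-separated, and the packing number at `2 * ε` bounds the
  -- covering number at `ε` from below.
  set c : ℝ≥0 := (κ * δ / 3).toNNReal with hc
  have hc' : (c : ℝ) = κ * δ / 3 := Real.coe_toNNReal _ (by positivity)
  have hc0 : 0 < c := Real.toNNReal_pos.2 (by positivity)
  have hcR : (0 : ℝ) < c := hc0
  have key : ∀ R : ℕ, 1 ≤ R → c ≤ R →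
      (R : ℝ) ^ (Fintype.card ι : ℝ) ≤ K * (1 / (c / R : ℝ)) ^ (D : ℝ) := by
    intro R hR hcR'
    have hR0 : (0 : ℝ) < R := by exact_mod_cast hR
    have hR0' : (0 : ℝ≥0) < R := by exact_mod_cast hR
    set ε : ℝ≥0 := c / R with hε
    have hε' : (ε : ℝ) = c / R := by simp [hε]
    set θ : (ι → Fin (R + 1)) → ι → ℝ := fun a i => δ * (a i : ℕ) / R with hθ
    have hθm : ∀ a i, θ a i ∈ Set.Icc 0 δ := by
      intro a i
      refine ⟨by positivity, ?_⟩
      rw [hθ, div_le_iff₀ hR0]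
      have : ((a i : ℕ) : ℝ) ≤ R := by exact_mod_cast Nat.lt_succ_iff.1 (a i).2
      gcongr
    have hθsep : ∀ a a', a ≠ a' → δ / R ≤ ‖θ a - θ a'‖ := by
      intro a a' h
      obtain ⟨i, hi⟩ := Function.ne_iff.1 h
      refine le_trans ?_ (norm_le_pi_norm (θ a - θ a') i)
      have h1 : (1 : ℝ) ≤ |((a i : ℕ) : ℝ) - (a' i : ℕ)| := by
        have h2 : ((a i : ℕ) : ℤ) - (a' i : ℕ) ≠ 0 := by
          rw [sub_ne_zero]
          exact fun h => hi (Fin.ext (by exact_mod_cast h))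
        exact_mod_cast Int.one_le_abs h2
      have e : (θ a - θ a') i = δ / R * (((a i : ℕ) : ℝ) - (a' i : ℕ)) := by
        simp only [hθ, Pi.sub_apply]; ring
      rw [Real.norm_eq_abs, e, abs_mul, abs_of_pos (by positivity : 0 < δ / R)]
      exact le_mul_of_one_le_right (by positivity) h1
    set r : (E → ℝ) → UniformFun X ℝ := fun g => UniformFun.ofFun (X.domRestrict g)
    have hdist : ∀ a a', a ≠ a' →
        ((2 * ε : ℝ≥0) : ℝ≥0∞) < edist (r (f (θ a))) (r (f (θ a'))) := by
      intro a a' h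
      have hn := hθsep a a' h
      have hne : θ a ≠ θ a' := by
        intro h'
        rw [h', sub_self, norm_zero] at hn
        exact absurd hn (not_le.2 (by positivity))
      obtain ⟨x, hx, hxs⟩ := hsep _ _ (hθm a) (hθm a') hne
      refine lt_of_lt_of_le ?_ (UniformFun.edist_eval_le (x := ⟨x, hx⟩))
      rw [edist_nndist, ENNReal.coe_lt_coe, ← NNReal.coe_lt_coe, coe_nndist, Real.dist_eq]
      change ((2 * ε : ℝ≥0) : ℝ) < |f (θ a) x - f (θ a') x|
      refine lt_of_lt_of_le ?_ hxs
      calc ((2 * ε : ℝ≥0) : ℝ) = 2 / 3 * (κ * (δ / R)) := by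
            rw [NNReal.coe_mul, hε', hc']; push_cast; ring
        _ < κ * (δ / R) := by
            have : 0 < κ * (δ / R) := by positivity
            linarith
        _ ≤ _ := by gcongr
    have hinj : Function.Injective fun a => r (f (θ a)) := by
      intro a a' h
      by_contra hne
      have h2 := hdist a a' hne
      rw [show r (f (θ a)) = r (f (θ a')) from h, edist_self] at h2
      exact not_lt_bot h2
    have hsepd : Metric.IsSeparated ((2 * ε : ℝ≥0) : ℝ≥0∞) (Set.range fun a => r (f (θ a))) := by
      rintro _ ⟨a, rfl⟩ _ ⟨a', rfl⟩ hne
      exact hdist a a' fun h => hne (by rw [h])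
    have hle : (((R + 1) ^ Fintype.card ι : ℕ) : ℕ∞) ≤ supCoveringNumber X F ε := by
      calc (((R + 1) ^ Fintype.card ι : ℕ) : ℕ∞)
          = (Set.range fun a => r (f (θ a))).encard := by
            rw [← Set.image_univ, hinj.encard_image, Set.encard_univ]
            simp
        _ ≤ Metric.packingNumber (2 * ε) (r '' F) := by
            refine hsepd.encard_le_packingNumber ?_
            rintro _ ⟨a, rfl⟩
            exact ⟨_, hf _ (hθm a), rfl⟩
        _ ≤ Metric.externalCoveringNumber ε (r '' F) :=
            Metric.packingNumber_two_mul_le_externalCoveringNumber _ _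
        _ ≤ _ := Metric.externalCoveringNumber_le_coveringNumber _ _
    have hfin := (ENat.toENNReal_le.2 hle).trans
      (hK ε (by positivity) ((div_le_one hR0').2 hcR'))
    rw [ENat.toENNReal_coe, ← ENNReal.coe_natCast, ENNReal.coe_le_coe, ← NNReal.coe_le_coe] at hfin
    push_cast at hfin
    rw [Real.rpow_natCast, ← hε']
    refine le_trans ?_ hfin
    gcongr
    linarith
  by_contra hlt
  rw [not_le, ← NNReal.coe_lt_coe, NNReal.coe_natCast] at hlt
  -- If `D` were smaller, `R ^ (card ι - D)` would be unbounded, whereas `key` bounds it by `K * (1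
  -- / c) ^ D`.
  have hT := (tendsto_rpow_atTop (sub_pos.2 hlt)).comp tendsto_natCast_atTop_atTop
  obtain ⟨R, hR1, hR2, hR3⟩ := ((hT.eventually_gt_atTop (K * (1 / (c : ℝ)) ^ (D : ℝ))).and
    ((Filter.eventually_ge_atTop 1).and (Filter.eventually_ge_atTop ⌈c⌉₊))).exists
  have hR0 : (0 : ℝ) < R := by exact_mod_cast hR2
  have h := key R hR2 ((Nat.le_ceil c).trans (by exact_mod_cast hR3))
  rw [show 1 / (c / R : ℝ) = 1 / c * R by field_simp, Real.mul_rpow (by positivity) hR0.le,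
    ← mul_assoc, ← div_le_iff₀ (by positivity), ← Real.rpow_sub hR0] at h
  exact absurd h (not_le.2 hR1)

/-- A matrix that is triangular with respect to an injective key and has nonzero diagonal entries
is injective. -/
theorem Matrix.mulVec_injective_of_triangular {ι : Type*} [Fintype ι] {N : ℕ} {key : ι → Fin N}
    (hkey : Function.Injective key) (M : Matrix ι ι ℝ) (hM : ∀ p p', key p < key p' → M p p' = 0)
    (hd : ∀ p, M p p ≠ 0) : Function.Injective M.mulVecLin := by
  rw [← LinearMap.ker_eq_bot, LinearMap.ker_eq_bot']
  intro v hv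
  have h : ∀ (r : ℕ) (p : ι), (key p : ℕ) = r → v p = 0 := by
    intro r
    induction r using Nat.strong_induction_on with
    | _ r ih =>
      intro p hp
      have h1 : ∑ p', M p p' * v p' = 0 := congrFun hv p
      rw [Finset.sum_eq_single p ?_ (by simp)] at h1
      · exact (mul_eq_zero.1 h1).resolve_left (hd p)
      · intro p' _ hne
        rcases lt_trichotomy (key p) (key p') with h | h | h
        · rw [hM _ _ h, zero_mul]
        · exact absurd (hkey h).symm hne
        · rw [ih (key p') (hp ▸ h) p' rfl, mul_zero]
  exact funext fun p => h _ p rfl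

/-! ### Lower bound: tents, sample points and the triangular system. -/

theorem tent_of_le {h t x : ℝ} (hh : 0 ≤ h) (hx : x ≤ t) : tent h t x = 0 := by
  rw [tent, max_eq_left (by linarith), max_eq_left (by linarith), max_eq_left (by linarith)]
  ring

theorem tent_of_ge {h t x : ℝ} (hh : 0 ≤ h) (hx : t + 2 * h ≤ x) : tent h t x = 0 := by
  rw [tent, max_eq_right (by linarith), max_eq_right (by linarith), max_eq_right (by linarith)]
  ring

theorem tent_of_mem {h t x : ℝ} (hx : t ≤ x) (hx' : x ≤ t + h) :
    tent h t x = (x - t) / 2 := by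
  rw [tent, max_eq_right (by linarith), max_eq_left (by linarith), max_eq_left (by linarith)]
  ring

theorem tent_le_one {h t x : ℝ} (hh : 0 ≤ h) (ht : 0 ≤ t) (hx : x ≤ 1) : tent h t x ≤ 1 := by
  have h1 : max 0 (x - t) ≤ 1 := max_le zero_le_one (by linarith)
  have h2 : max 0 (x - (t + 2 * h)) ≤ 1 := max_le zero_le_one (by linarith)
  have h3 : 0 ≤ max 0 (x - (t + h)) := le_max_left _ _
  rw [tent]
  linarith

/-- If `(L, W)` leaves room for `m` blocks with `n` units, then the covering exponents of `mlpClass`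
are at least `m * n ^ 2`. -/
theorem le_of_hasCoveringExponent_mlpClass {d W L n m : ℕ} {b : ℝ} (hd : 1 ≤ d) (hdW : d ≤ W)
    (hb : 1 ≤ b) (hn : 1 ≤ n) (hm : 1 ≤ m) (hW : 3 * n + 2 ≤ W) (hL : 3 * m + 2 ≤ L) {D : ℝ≥0}
    (hD : HasCoveringExponent (Set.Icc (0 : Fin d → ℝ) 1) (mlpClass d W L b) D) :
    ((m * n ^ 2 : ℕ) : ℝ≥0) ≤ D := by
  have hn0 : (1 : ℝ) ≤ n := by exact_mod_cast hn
  have hm0 : (1 : ℝ) ≤ m := by exact_mod_cast hm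
  -- The `m * n` tents of all blocks have supports of length `2 * h` that tile `[0, 1]`.
  set h : ℝ := 1 / (2 * m * n) with hh
  have hh0 : 0 < h := by positivity
  have hhmn : 2 * h * (m * n) = 1 := by rw [hh]; field_simp
  have hh1 : h ≤ 1 := by rw [hh, div_le_one (by positivity)]; nlinarith
  set η : ℝ := h / (2 * (n + 1)) with hη
  have hη0 : 0 < η := by positivity
  have hηh : 2 * η * (n + 1) = h := by rw [hη]; field_simp
  set t : ℕ → Fin n → ℝ := fun j k => ((k : ℕ) + n * j : ℕ) * (2 * h) with ht
  set τ : Fin n → ℝ := fun i => (i : ℕ) * η with hτ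
  set q : Fin m × Fin n → Fin (m * n) := fun p => finProdFinEquiv p with hq
  have htq : ∀ (j : Fin m) k, t j k = (q (j, k) : ℕ) * (2 * h) := fun j k => rfl
  have ht01 : ∀ j < m, ∀ k, 0 ≤ t j k ∧ t j k + 2 * h ≤ 1 := by
    intro j hj k
    refine ⟨by positivity, ?_⟩
    have h1 : ((q (⟨j, hj⟩, k) : ℕ) : ℝ) + 1 ≤ m * n := by
      exact_mod_cast (q (⟨j, hj⟩, k)).2
    have h2 := htq ⟨j, hj⟩ k
    simp only at h2
    rw [h2]
    nlinarith
  have hτ0 : ∀ i, 0 ≤ τ i := fun i => by positivity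
  have hτ1 : ∀ i, |τ i| ≤ 1 := by
    intro i
    have : ((i : ℕ) : ℝ) ≤ n := by exact_mod_cast i.2.le
    rw [abs_of_nonneg (hτ0 i)]
    simp only [hτ]
    nlinarith
  set u : Fin m → Fin n → ℝ → ℝ := fun j i x => max 0 (∑ l, tent h (t j l) x - τ i) with hu
  have hu0 : ∀ j i x, 0 ≤ u j i x := fun _ _ _ => le_max_left _ _
  have hu1 : ∀ j i x, x ≤ 1 → u j i x ≤ n := by
    intro j i x hx
    refine max_le (by positivity) ?_
    have : ∑ l, tent h (t j l) x ≤ ∑ _l : Fin n, (1 : ℝ) :=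
      Finset.sum_le_sum fun l _ => tent_le_one hh0.le (ht01 j j.2 l).1 hx
    simp only [Finset.sum_const, Finset.card_univ, Fintype.card_fin, nsmul_eq_mul, mul_one] at this
    linarith [hτ0 i]
  -- On the rising half of tent `(j, k)`, the sum of the tents of block `j` equals `(i + 1) * η` at
  -- `ξ (j, k, i)`. This exceeds exactly the thresholds `τ i' = i' * η` with `i' ≤ i`.
  set ξ : Fin m × Fin n × Fin n → ℝ :=
    fun p => t p.1 p.2.1 + ((p.2.2 : ℕ) + 1) * (2 * η) with hξ
  have hξt : ∀ p, t p.1 p.2.1 ≤ ξ p := fun p => by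
    have : 0 ≤ (((p.2.2 : ℕ) : ℝ) + 1) * (2 * η) := by positivity
    simp only [hξ]; linarith
  have hξh : ∀ p, ξ p ≤ t p.1 p.2.1 + h := by
    intro p
    have : (((p.2.2 : ℕ) : ℝ) + 1) ≤ n := by exact_mod_cast p.2.2.2
    simp only [hξ]
    nlinarith
  have hξ0 : ∀ p, 0 ≤ ξ p := fun p => (ht01 _ p.1.2 _).1.trans (hξt p)
  have hξ1 : ∀ p, ξ p ≤ 1 := fun p => by linarith [hξh p, (ht01 _ p.1.2 p.2.1).2]
  have hgrid : ∀ (j : Fin m) k (j' : Fin m) k', q (j, k) < q (j', k') → t j k + 2 * h ≤ t j' k' := by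
    intro j k j' k' hlt
    have : ((q (j, k) : ℕ) : ℝ) + 1 ≤ (q (j', k') : ℕ) := by exact_mod_cast hlt
    rw [htq, htq]
    nlinarith
  have hgrid' : ∀ (j : Fin m) k (j' : Fin m) k', q (j, k) ≤ q (j', k') → t j k ≤ t j' k' := by
    intro j k j' k' hle
    rw [htq, htq]
    gcongr
    exact hle
  have huξ : ∀ j k i i', u j i' (ξ (j, k, i)) = max 0 ((((i : ℕ) : ℝ) + 1 - (i' : ℕ)) * η) := by
    intro j k i i'
    have hsum : ∑ l, tent h (t j l) (ξ (j, k, i)) = (((i : ℕ) : ℝ) + 1) * η := by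
      rw [Finset.sum_eq_single k ?_ (by simp)]
      · rw [tent_of_mem (hξt (j, k, i)) (hξh (j, k, i))]
        simp only [hξ]; ring
      · intro l _ hlk
        have hq' : ∀ a b : Fin n, a < b → q (j, a) < q (j, b) := by
          intro a b hab
          have hab' : (a : ℕ) < b := hab
          rw [Fin.lt_def]
          simp only [hq, finProdFinEquiv_apply_val]
          omega
        rcases lt_or_gt_of_ne hlk with hlt | hgt
        · refine tent_of_ge hh0.le ((hgrid _ _ _ _ (hq' _ _ hlt)).trans (hξt (j, k, i)))
        · have h1 := hgrid _ _ _ _ (hq' _ _ hgt)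
          have h2 := hξh (j, k, i)
          exact tent_of_le hh0.le (by simp only at h2; linarith)
    simp only [hu, hsum, hτ]
    congr 1
    ring
  -- Linear part in `θ` of the values at the sample points: the outer units at or to the left of the
  -- current tent are active, the others are off. In the order of `(q (j, k), i)` it is lower
  -- triangular with diagonal `η`.
  set M : Matrix (Fin m × Fin n × Fin n) (Fin m × Fin n × Fin n) ℝ := Matrix.of fun p p' =>
    if q (p'.1, p'.2.1) ≤ q (p.1, p.2.1) then u p'.1 p'.2.2 (ξ p) else 0 with hM
  have hinj : Function.Injective M.mulVecLin := by
    refine Matrix.mulVec_injective_of_triangular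
      (key := fun p => finProdFinEquiv (q (p.1, p.2.1), p.2.2)) ?_ M ?_ ?_
    · rintro ⟨j, k, i⟩ ⟨j', k', i'⟩ hp
      have h1 := finProdFinEquiv.injective hp
      simp only [Prod.mk.injEq] at h1
      have h2 := finProdFinEquiv.injective h1.1
      simp only [Prod.mk.injEq] at h2
      rw [h2.1, h2.2, h1.2]
    · rintro ⟨j, k, i⟩ ⟨j', k', i'⟩ hlt
      rw [Fin.lt_def] at hlt
      simp only [finProdFinEquiv_apply_val] at hlt
      simp only [hM, Matrix.of_apply]
      split_ifs with hle
      · rcases hle.lt_or_eq with hl | he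
        · have h1 : (q (j', k') : ℕ) + 1 ≤ q (j, k) := hl
          have h2 := Nat.mul_le_mul_left n h1
          have := i'.2
          rw [mul_add] at h2
          omega
        · rw [he] at hlt
          have h2 := finProdFinEquiv.injective he
          simp only [Prod.mk.injEq] at h2
          rw [h2.1, huξ]
          have h3 : ((i : ℕ) : ℝ) + 1 ≤ (i' : ℕ) := by exact_mod_cast Nat.lt_of_add_lt_add_right hlt
          exact max_eq_left (by nlinarith)
      · rfl
    · rintro ⟨j, k, i⟩
      simp only [hM, Matrix.of_apply, le_refl, if_true, huξ, add_sub_cancel_left, one_mul]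
      rw [max_eq_right hη0.le]
      exact hη0.ne'
  obtain ⟨κ, hκ0, hκ⟩ := M.mulVecLin.exists_antilipschitzWith (LinearMap.ker_eq_bot.2 hinj)
  have hκ0' : (0 : ℝ) < κ := hκ0
  -- As `u ≤ n`, this gives `∑ i, θ * u ≤ n * (δ * n) = h`. A unit of a later tent has `ξ p - t j k
  -- ≤ -h`, so the perturbation cannot switch it on.
  set δ : ℝ := h / n ^ 2 with hδ
  have hδ0 : 0 < δ := by positivity
  have hδn : n * (δ * n) = h := by rw [hδ]; field_simp
  have hδ1 : δ ≤ 1 := (div_le_self hh0.le (one_le_pow₀ hn0)).trans hh1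
  -- the network with parameters `θ`
  have hex : ∀ θ : Fin m × Fin n × Fin n → ℝ, ∃ f : (Fin d → ℝ) → ℝ,
      (∀ p, θ p ∈ Set.Icc 0 δ) → f ∈ mlpClass d W L b ∧
      ∀ x : Fin d → ℝ, 0 ≤ x ⟨0, hd⟩ → f x = ∑ j : Fin m, ∑ k,
        max 0 (∑ i, θ (j, k, i) * u j i (x ⟨0, hd⟩) + (x ⟨0, hd⟩ - t j k)) := by
    intro θ
    by_cases hθ : ∀ p, θ p ∈ Set.Icc 0 δ
    · obtain ⟨f, hf, e⟩ := exists_mlpClass_sum_blocks (t := t)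
        (θ := fun j k i => if hj : j < m then θ (⟨j, hj⟩, k, i) else 0) hd hdW hW hh0.le hτ1
        (by
          intro j k i
          split_ifs with hj
          · rw [abs_of_nonneg (hθ _).1]
            exact (hθ _).2.trans hδ1
          · simp) (L - (3 * m + 2)) m ht01
      rw [show L - (3 * m + 2) + 1 + 3 * m + 1 = L by omega] at hf
      refine ⟨f, fun _ => ⟨mlpClass_mono hb hf, fun x hx => ?_⟩⟩
      rw [e x hx, Finset.sum_range]
      simp [blockFun, hu]
    -- A default value outside the parameter cube, so that `f` is defined for every `θ`.
    · exact ⟨0, fun h' => absurd h' hθ⟩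
  choose f hf using hex
  have hval : ∀ θ : Fin m × Fin n × Fin n → ℝ, (∀ p, θ p ∈ Set.Icc 0 δ) → ∀ p,
      f θ (fun _ => ξ p) = M.mulVecLin θ p +
        ∑ j : Fin m, ∑ k, if q (j, k) ≤ q (p.1, p.2.1) then ξ p - t j k else 0 := by
    intro θ hθ p
    rw [(hf θ hθ).2 _ (hξ0 p), Matrix.mulVecLin_apply, Matrix.mulVec, dotProduct,
      Fintype.sum_prod_type, ← Finset.sum_add_distrib]
    refine Finset.sum_congr rfl fun j _ => ?_
    rw [Fintype.sum_prod_type, ← Finset.sum_add_distrib]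
    refine Finset.sum_congr rfl fun k _ => ?_
    simp only [hM, Matrix.of_apply]
    split_ifs with hle
    · rw [max_eq_right]
      · simp only [mul_comm]
      · refine add_nonneg (Finset.sum_nonneg fun i _ => mul_nonneg (hθ _).1 (hu0 _ _ _)) ?_
        linarith [hgrid' _ _ _ _ hle, hξt p]
    · rw [max_eq_left]
      · simp
      · have h1 := hgrid _ _ _ _ (not_le.1 hle)
        have h2 : ∑ i, θ (j, k, i) * u j i (ξ p) ≤ ∑ _i : Fin n, δ * n :=
          Finset.sum_le_sum fun i _ =>
            mul_le_mul (hθ _).2 (hu1 _ _ _ (hξ1 p)) (hu0 _ _ _) hδ0.le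
        rw [Finset.sum_const, Finset.card_univ, Fintype.card_fin, nsmul_eq_mul, hδn] at h2
        linarith [hξh p]
  have hcard : m * n ^ 2 = Fintype.card (Fin m × Fin n × Fin n) := by
    simp only [Fintype.card_prod, Fintype.card_fin]; ring
  rw [hcard]
  refine card_le_of_hasCoveringExponent hD f hδ0 (κ := (κ : ℝ)⁻¹) (by positivity)
    (fun θ hθ => (hf θ hθ).1) fun θ θ' hθ hθ' hne => ?_
  have hanti := hκ.le_mul_dist θ θ'
  have : Nonempty (Fin m × Fin n × Fin n) := ⟨(⟨0, hm⟩, ⟨0, hn⟩, ⟨0, hn⟩)⟩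
  obtain ⟨p, hp⟩ : ∃ p, ‖M.mulVecLin θ - M.mulVecLin θ'‖ =
      ‖(M.mulVecLin θ - M.mulVecLin θ') p‖ := by
    obtain ⟨p, -, hp⟩ := Finset.exists_mem_eq_sup' Finset.univ_nonempty
      (fun p => ‖(M.mulVecLin θ - M.mulVecLin θ') p‖)
    refine ⟨p, le_antisymm ?_ (norm_le_pi_norm _ p)⟩
    refine (pi_norm_le_iff_of_nonneg (norm_nonneg _)).2 fun p' => ?_
    rw [← hp]
    exact Finset.le_sup' (fun p => ‖(M.mulVecLin θ - M.mulVecLin θ') p‖) (Finset.mem_univ p')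
  refine ⟨fun _ => ξ p, ⟨fun _ => hξ0 p, fun _ => hξ1 p⟩, ?_⟩
  -- The term without `θ` cancels, so the difference of values is the coordinate of `M θ - M θ'` of
  -- largest absolute value.
  rw [hval θ hθ, hval θ' hθ', add_sub_add_right_eq_sub]
  rw [dist_eq_norm, dist_eq_norm, hp] at hanti
  rwa [inv_mul_le_iff₀ hκ0']

/-! ### Both bounds with explicit constants. -/

theorem theorem7 :
    ∃ c C : ℝ≥0, 0 < c ∧ 0 < C ∧
      ∀ (d W L : ℕ) (b B : ℝ), 1 ≤ d → d ≤ W → 1 ≤ L → 1 ≤ b → (((W : ℝ) + 1) * b) ^ L ≤ B →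
        (∀ (X : Set (Fin d → ℝ)) (F : Set ((Fin d → ℝ) → ℝ)),
          X ⊆ Set.Icc 0 1 → F ⊆ mlpClass d W L b →
            (∃ D : ℝ≥0, D ≤ C * (W : ℝ≥0) ^ 2 * (L : ℝ≥0) ∧ BoundedCovering X F B D) ∧
            effectiveDim X F ≤ ((C * (W : ℝ≥0) ^ 2 * (L : ℝ≥0) : ℝ≥0) : ℝ≥0∞)) ∧
        (60 ≤ W → 60 ≤ L →
          ((c * (W : ℝ≥0) ^ 2 * (L : ℝ≥0) : ℝ≥0) : ℝ≥0∞) ≤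
              effectiveDim (Set.Icc (0 : Fin d → ℝ) 1) (mlpClass d W L b) ∧
            effectiveDim (Set.Icc (0 : Fin d → ℝ) 1) (mlpClass d W L b) ≤
              ((C * (W : ℝ≥0) ^ 2 * (L : ℝ≥0) : ℝ≥0) : ℝ≥0∞)) := by
  -- `C = 2` comes from `W + 1 ≤ 2 * W`. With `n = (W - 2) / 3 ≥ W / 4` and `m = (L - 2) / 3 ≥ L /
  -- 4`, the dimension `m * n ^ 2` is at least `W ^ 2 * L / 64`.
  refine ⟨1 / 64, 2, by positivity, by positivity, fun d W L b B hd hdW hL hb hB => ?_⟩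
  have hDle : ((L * (W * (W + 1)) : ℕ) : ℝ≥0) ≤ 2 * (W : ℝ≥0) ^ 2 * (L : ℝ≥0) := by
    have hle : L * (W * (W + 1)) ≤ 2 * W ^ 2 * L := by
      have := Nat.mul_le_mul_left (L * W) (hd.trans hdW)
      nlinarith
    exact_mod_cast hle
  have upper : ∀ (X : Set (Fin d → ℝ)) (F : Set ((Fin d → ℝ) → ℝ)),
      X ⊆ Set.Icc 0 1 → F ⊆ mlpClass d W L b →
        effectiveDim X F ≤ ((2 * (W : ℝ≥0) ^ 2 * (L : ℝ≥0) : ℝ≥0) : ℝ≥0∞) := fun X F hX hF =>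
    (iInf₂_le _ (hasCoveringExponent_of_subset_mlpClass hd hdW hL hb hX hF)).trans
      (ENNReal.coe_le_coe.2 hDle)
  refine ⟨fun X F hX hF => ⟨⟨_, hDle, hX, fun f hf x hx => mlpClass_mem_Icc hb hB (hF hf) (hX hx),
    hasCoveringExponent_of_subset_mlpClass hd hdW hL hb hX hF⟩, upper X F hX hF⟩,
    fun hW60 hL60 => ⟨le_iInf₂ fun D hD => ENNReal.coe_le_coe.2 ?_, upper _ _ le_rfl le_rfl⟩⟩
  refine le_trans ?_ (le_of_hasCoveringExponent_mlpClass (n := (W - 2) / 3) (m := (L - 2) / 3)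
    hd hdW hb (by omega) (by omega) (by omega) (by omega) hD)
  have h1 : (W : ℝ≥0) ≤ 4 * ((W - 2) / 3 : ℕ) := by
    have : W ≤ 4 * ((W - 2) / 3) := by omega
    exact_mod_cast this
  have h2 : (L : ℝ≥0) ≤ 4 * ((L - 2) / 3 : ℕ) := by
    have : L ≤ 4 * ((L - 2) / 3) := by omega
    exact_mod_cast this
  calc 1 / 64 * (W : ℝ≥0) ^ 2 * L
      ≤ 1 / 64 * (4 * ((W - 2) / 3 : ℕ)) ^ 2 * (4 * ((L - 2) / 3 : ℕ)) := by gcongr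
    _ = (((L - 2) / 3 * ((W - 2) / 3) ^ 2 : ℕ) : ℝ≥0) := by
        push_cast
        ring
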